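/- Let $f(x)=\tfrac12x^2$ on $\mathbb{R}$ and, for $t>0$, let $\alpha_t=\log(2/t)$, $\beta_t=\gamma_t=2\log t$, so that the Hamiltonian $$\hat H(t)=e^{\alpha_t-\gamma_t}\Big(-\tfrac12\,\partial_x^2\Big)+e^{\alpha_t+\beta_t+\gamma_t}f(x)$$ on $L^2(\mathbb{R})$, with domain $\{\psi\in L^2(\mathbb{R}):\psi''\in L^2(\mathbb{R}),\ f\psi\in L^2(\mathbb{R})\}$, equals $-t^{-3}\partial_x^2+t^3x^2$. Let $t_0>0$ and consider the Schrödinger equation $$i\,\partial_t\Psi_t=\hat H(t)\Psi_t\quad(t>t_0),\qquad \Psi_{t_0}(x)=\Big(\frac1{2\pi}\Big)^{1/4}\exp\Big(-\frac{x^2}{4}\Big),$$ where a solution is a continuous map $t\mapsto\Psi_t\in L^2(\mathbb{R})$ on $[t_0,\infty)$ that takes the initial value at $t_0$, and that for every $t>t_0$ is differentiable in $L^2(\mathbb{R})$, lies in the domain of $\hat H(t)$ and satisfies the equation. Then there is exactly one solution $\Psi$; the expectation $$\mathbb{E}[f]_{\sim\Psi_t}=\int_{\mathbb{R}}f(x)\,|\Psi_t(x)|^2\,dx$$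 is finite for every $t\ge t_0$; and $$\mathbb{E}[f]_{\sim\Psi_t}=\Theta(t^{-3})\qquad(t\to\infty),$$ that is, there are constants $c,C,T>0$ (depending on $t_0$) with $c\,t^{-3}\le\mathbb{E}[f]_{\sim\Psi_t}\le C\,t^{-3}$ for all $t\ge T$. -/

import Mathlib

open MeasureTheory Set Filter Asymptotics
open scoped SchwartzMap Laplacian ENNReal

noncomputable section

namespace QHD

/-- The Hilbert space `L²(ℝ; ℂ)`. -/
abbrev L2 : Type := Lp ℂ 2 (volume : Measure ℝ)

/-- The pairs `(ψ, g)` of `L²` functions with `ψ'' = g` in the sense of distributions. -/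
def laplacianGraph : Submodule ℂ (L2 × L2) where
  carrier := {p | Δ (p.1 : 𝓢'(ℝ, ℂ)) = (p.2 : 𝓢'(ℝ, ℂ))}
  zero_mem' := by
    have h := map_zero (Lp.toTemperedDistributionCLM ℂ (volume : Measure ℝ) 2)
    have h' := map_zero (LineDeriv.laplacianCLM ℂ ℝ 𝓢'(ℝ, ℂ))
    simp only [Lp.toTemperedDistributionCLM_apply,
      TemperedDistribution.laplacianCLM_apply] at h h'
    simp [h, h']
  add_mem' := by
    intro p q hp hq
    have h := map_add (Lp.toTemperedDistributionCLM ℂ (volume : Measure ℝ) 2)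
    have h' := map_add (LineDeriv.laplacianCLM ℂ ℝ 𝓢'(ℝ, ℂ))
    simp only [Lp.toTemperedDistributionCLM_apply,
      TemperedDistribution.laplacianCLM_apply] at h h'
    simp only [mem_ofPred_eq, Prod.fst_add, Prod.snd_add, h, h'] at hp hq ⊢
    rw [hp, hq]
  smul_mem' := by
    intro c p hp
    have h := map_smul (Lp.toTemperedDistributionCLM ℂ (volume : Measure ℝ) 2)
    have h' := map_smul (LineDeriv.laplacianCLM ℂ ℝ 𝓢'(ℝ, ℂ))
    simp only [Lp.toTemperedDistributionCLM_apply,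
      TemperedDistribution.laplacianCLM_apply] at h h'
    simp only [mem_ofPred_eq, Prod.smul_fst, Prod.smul_snd, h, h'] at hp ⊢
    rw [hp]

/-- The second derivative `∂ₓ²` as an unbounded operator on `L²(ℝ)`, with domain
`{ψ ∈ L² : ψ'' ∈ L²} = H²(ℝ)`. -/
def laplacian : L2 →ₗ.[ℂ] L2 := laplacianGraph.toLinearPMap

/-- The pairs `(ψ, g)` of `L²` functions with `V ψ = g` almost everywhere. -/
def potentialGraph (V : ℝ → ℝ) : Submodule ℂ (L2 × L2) where
  carrier := {p | (fun x => (V x : ℂ) * p.1 x) =ᵐ[volume] p.2}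
  zero_mem' := by
    filter_upwards [Lp.coeFn_zero ℂ 2 (volume : Measure ℝ)] with x hx
    change (V x : ℂ) * (0 : L2) x = (0 : L2) x
    rw [hx, Pi.zero_apply, mul_zero]
  add_mem' := by
    intro p q hp hq
    filter_upwards [hp, hq, Lp.coeFn_add p.1 q.1, Lp.coeFn_add p.2 q.2] with x h1 h2 h3 h4
    simp only [Prod.fst_add, Prod.snd_add, h3, h4, Pi.add_apply, mul_add, h1, h2]
  smul_mem' := by
    intro c p hp
    filter_upwards [hp, Lp.coeFn_smul c p.1, Lp.coeFn_smul c p.2] with x h1 h2 h3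
    simp only [Prod.smul_fst, Prod.smul_snd, h2, h3, Pi.smul_apply, smul_eq_mul, ← h1]
    ring

/-- Multiplication by the real function `V` as an unbounded operator on `L²(ℝ)`, with domain
`{ψ ∈ L² : V ψ ∈ L²}`. -/
def potential (V : ℝ → ℝ) : L2 →ₗ.[ℂ] L2 := (potentialGraph V).toLinearPMap

/-- The two sets of pairs are graphs of functions, so the operators are the intended ones. -/
theorem laplacian_graph : laplacian.graph = laplacianGraph := by
  refine Submodule.toLinearPMap_graph_eq _ ?_
  rintro ⟨x, y⟩ h rfl
  have h0 : (y : 𝓢'(ℝ, ℂ)) = 0 := by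
    have h' := map_zero (LineDeriv.laplacianCLM ℂ ℝ 𝓢'(ℝ, ℂ))
    have h1 := map_zero (Lp.toTemperedDistributionCLM ℂ (volume : Measure ℝ) 2)
    simp only [Lp.toTemperedDistributionCLM_apply,
      TemperedDistribution.laplacianCLM_apply] at h1 h'
    have h2 : Δ ((0 : L2) : 𝓢'(ℝ, ℂ)) = (y : 𝓢'(ℝ, ℂ)) := h
    rw [← h2, h1, h']
  have hk := Lp.ker_toTemperedDistributionCLM_eq_bot (F := ℂ) (μ := (volume : Measure ℝ)) (p := 2)
  rw [← Submodule.mem_bot ℂ, ← hk]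
  exact h0

theorem potential_graph (V : ℝ → ℝ) : (potential V).graph = potentialGraph V := by
  refine Submodule.toLinearPMap_graph_eq _ ?_
  rintro ⟨x, y⟩ h rfl
  have h2 : (fun x => (V x : ℂ) * (0 : L2) x) =ᵐ[volume] y := h
  refine Lp.ext ?_
  filter_upwards [h2, Lp.coeFn_zero ℂ 2 (volume : Measure ℝ)] with x h3 h4
  simp only [h4, Pi.zero_apply, mul_zero] at h3 ⊢
  exact h3.symm

/-- The Hamiltonian `e^{α_t - γ_t} (-½ ∂ₓ²) + e^{α_t + β_t + γ_t} f(x)`, on the intersection of the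
domains of its two summands. -/
def hamiltonian (α β γ : ℝ → ℝ) (f : ℝ → ℝ) (t : ℝ) : L2 →ₗ.[ℂ] L2 :=
  (-((Real.exp (α t - γ t) / 2 : ℝ) : ℂ)) • laplacian +
    ((Real.exp (α t + β t + γ t) : ℝ) : ℂ) • potential f

/-- The parameters `α_t = log (2 / t)`, `β_t = 2 log t`, `γ_t = 2 log t`. -/
def alpha (t : ℝ) : ℝ := Real.log (2 / t)
/-- See `alpha`. -/
def beta (t : ℝ) : ℝ := 2 * Real.log t
/-- See `alpha`. -/
def gamma (t : ℝ) : ℝ := 2 * Real.log t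

/-- The objective function `f(x) = x² / 2`. -/
def objective (x : ℝ) : ℝ := x ^ 2 / 2

/-- With these parameters and this objective the Hamiltonian is `-t⁻³ ∂ₓ² + t³ x²`. -/
theorem hamiltonian_eq {t : ℝ} (ht : 0 < t) :
    hamiltonian alpha beta gamma objective t =
      (-((t ^ 3)⁻¹ : ℂ)) • laplacian + (2 * (t : ℂ) ^ 3) • potential objective := by
  have e : Real.exp (2 * Real.log t) = t ^ 2 := by
    rw [two_mul, Real.exp_add, Real.exp_log ht, sq]
  have h1 : Real.exp (alpha t - gamma t) / 2 = (t ^ 3)⁻¹ := by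
    rw [alpha, gamma, Real.exp_sub, Real.exp_log (by positivity), e]
    field_simp
  have h2 : Real.exp (alpha t + beta t + gamma t) = 2 * t ^ 3 := by
    rw [alpha, beta, gamma, Real.exp_add, Real.exp_add, Real.exp_log (by positivity), e]
    field_simp
  rw [hamiltonian, h1, h2]
  push_cast
  rfl

/-- `Ψ` solves `i ∂ₜ Ψ_t = H(t) Ψ_t` on `[t₀, ∞)` in `L²(ℝ)` with initial wave function `Ψ₀` at time
`t₀`: it is continuous on `[t₀, ∞)` and, for `t > t₀`, differentiable as an `L²`-valued function,
with `Ψ_t` in the domain of `H(t)`. -/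
structure IsSolution (H : ℝ → L2 →ₗ.[ℂ] L2) (t₀ : ℝ) (Ψ₀ : ℝ → ℂ) (Ψ : ℝ → L2) : Prop where
  continuousOn : ContinuousOn Ψ (Ici t₀)
  initial : Ψ t₀ =ᵐ[volume] Ψ₀
  equation : ∀ t > t₀, ∃ (hdom : Ψ t ∈ (H t).domain) (Ψ' : L2),
    HasDerivAt Ψ Ψ' t ∧ Complex.I • Ψ' = H t ⟨Ψ t, hdom⟩

/-- The initial wave function `(1 / (2π))^{1/4} exp (-x² / 4)`. -/
def gaussian (x : ℝ) : ℂ :=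
  (((1 / (2 * Real.pi)) ^ (1 / 4 : ℝ) * Real.exp (-x ^ 2 / 4) : ℝ) : ℂ)

/-- The expectation `⟨ψ| f |ψ⟩ = ∫ f(x) |ψ(x)|² dx`. -/
def expectation (f : ℝ → ℝ) (ψ : L2) : ℝ := ∫ x, f x * ‖ψ x‖ ^ 2

end QHD

end

open FourierTransform Topology BoundedContinuousFunction

namespace QHD

/-! Uniqueness is conservation of norm: the Hamiltonian is symmetric, so the norm of a difference of
two solutions is constant (`IsSolution.eqOn`).

For existence, the Hamiltonian is quadratic, so a Gaussian `exp (a - b x² / 2)` remains Gaussian as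
long as `b` solves a Riccati equation and `a' = -i t⁻³ b` (`isSolution_gaussianWave`). The
substitution `b = -(i/2) t³ u'/u` linearises the Riccati equation to `u'' + (3/t) u' + 4 u = 0`, the
damped oscillator. For `u = p + i q` normalised by the Wronskian identity `t³ (p q' - q p') = 1`,
one gets `Re b = 1 / (2 |u|²)` and `|e^a|² |u|` constant. The Gaussian second moment scales like
`|e^a|² (Re b)^(-3/2)`, so the expectation is a constant multiple of `|u|²`
(`exists_gaussian_parameters`).

It remains to see that `|u|²` has exact order `t⁻³`. The energies of `p` and `q` are `O(t⁻³)`, which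
is the upper bound; if `|u|²` were smaller, the Wronskian could not stay at `t⁻³`, by Cauchy-Schwarz
(`IsClassicalSolution.isTheta`). -/

/-! ### Symmetry of the Hamiltonian and uniqueness -/

theorem eq_hamiltonian_iff {t : ℝ} (ht : 0 < t) (ψ g : L2) :
    (∃ h : ψ ∈ (hamiltonian alpha beta gamma objective t).domain,
      hamiltonian alpha beta gamma objective t ⟨ψ, h⟩ = g) ↔
    ∃ g₁ g₂ : L2, (ψ, g₁) ∈ laplacianGraph ∧ (ψ, g₂) ∈ potentialGraph objective ∧
      g = (-((t ^ 3)⁻¹ : ℂ)) • g₁ + (2 * (t : ℂ) ^ 3) • g₂ := by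
  rw [hamiltonian_eq ht]
  constructor
  · rintro ⟨h, rfl⟩
    obtain ⟨h₁, h₂⟩ := Submodule.mem_inf.1 h
    refine ⟨laplacian ⟨ψ, h₁⟩, potential objective ⟨ψ, h₂⟩, ?_, ?_, rfl⟩
    · rw [← laplacian_graph]; exact laplacian.mem_graph ⟨ψ, h₁⟩
    · rw [← potential_graph]; exact (potential objective).mem_graph ⟨ψ, h₂⟩
  · rintro ⟨g₁, g₂, h₁, h₂, rfl⟩
    rw [← laplacian_graph, LinearPMap.mem_graph_iff] at h₁
    rw [← potential_graph, LinearPMap.mem_graph_iff] at h₂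
    obtain ⟨⟨y, hy⟩, rfl, rfl⟩ := h₁
    obtain ⟨⟨z, hz⟩, h, rfl⟩ := h₂
    obtain rfl : z = y := h
    exact ⟨⟨hy, hz⟩, rfl⟩

/-- If `g` is a real multiple of `ψ` pointwise, then `⟪ψ, g⟫` is real. -/
theorem inner_im_eq_zero_of_ae_eq_real_mul {ψ g : L2} (r : ℝ → ℝ)
    (h : ∀ᵐ x, (r x : ℂ) * ψ x = g x) : (inner ℂ ψ g).im = 0 := by
  rw [← Complex.conj_eq_iff_im, L2.inner_def, ← integral_conj]
  refine integral_congr_ae ?_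
  filter_upwards [h] with x hx
  rw [← hx]
  simp only [RCLike.inner_apply, map_mul, Complex.conj_ofReal, Complex.conj_conj]
  ring

theorem potentialGraph_inner_im {V : ℝ → ℝ} {ψ g : L2} (h : (ψ, g) ∈ potentialGraph V) :
    (inner ℂ ψ g).im = 0 :=
  inner_im_eq_zero_of_ae_eq_real_mul V h

/-- The Fourier transform turns the distributional second derivative into a multiplication. -/
theorem laplacianGraph_fourier {ψ g : L2} (h : (ψ, g) ∈ laplacianGraph) :
    ∀ᵐ x : ℝ, ((-(2 * Real.pi) ^ 2 * x ^ 2 : ℝ) : ℂ) * (𝓕 ψ : L2) x = (𝓕 g : L2) x := by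
  have hL : Δ (ψ : 𝓢'(ℝ, ℂ)) = (g : 𝓢'(ℝ, ℂ)) := h
  have h1 : ((-(2 * Real.pi) ^ 2 : ℝ) : ℂ) • TemperedDistribution.smulLeftCLM ℂ
      (fun x : ℝ ↦ Complex.ofReal (‖x‖ ^ 2)) ((𝓕 ψ : L2) : 𝓢'(ℝ, ℂ)) =
      ((𝓕 g : L2) : 𝓢'(ℝ, ℂ)) := by
    rw [← Lp.fourier_toTemperedDistribution_eq, ← Lp.fourier_toTemperedDistribution_eq, ← hL,
      TemperedDistribution.laplacian_eq_fourierMultiplierCLM,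
      TemperedDistribution.fourierMultiplierCLM_apply, ← Complex.coe_smul,
      FourierTransform.fourier_smul, FourierTransform.fourier_fourierInv_eq]
  have hψ : LocallyIntegrable (𝓕 ψ : L2) := (Lp.memLp _).locallyIntegrable (by norm_num)
  have hg : LocallyIntegrable (𝓕 g : L2) := (Lp.memLp _).locallyIntegrable (by norm_num)
  -- Locally integrable functions are determined by smooth compactly supported tests, and these are
  -- Schwartz functions.
  refine ae_eq_of_integral_contDiff_smul_eq ?_ hg ?_
  · exact hψ.continuous_smul (g := fun x : ℝ => ((-(2 * Real.pi) ^ 2 * x ^ 2 : ℝ) : ℂ))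
      (by fun_prop)
  intro φ hφ hc
  obtain ⟨Φ, hΦ⟩ : ∃ Φ : 𝓢(ℝ, ℂ), ∀ x, Φ x = (φ x : ℂ) :=
    ⟨(hc.comp_left (g := Complex.ofReal) rfl).toSchwartzMap
      (Complex.ofRealCLM.contDiff.comp hφ), fun _ => rfl⟩
  have h2 := DFunLike.congr_fun h1 Φ
  change ((-(2 * Real.pi) ^ 2 : ℝ) : ℂ) • (((𝓕 ψ : L2) : 𝓢'(ℝ, ℂ)) (SchwartzMap.smulLeftCLM ℂ _ _))
    = _ at h2
  rw [Lp.toTemperedDistribution_apply, Lp.toTemperedDistribution_apply, ← integral_smul] at h2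
  refine (integral_congr_ae (ae_of_all _ fun x => ?_)).trans (h2.trans
    (integral_congr_ae (ae_of_all _ fun x => ?_)))
  · rw [SchwartzMap.smulLeftCLM_apply_apply (by fun_prop), hΦ]
    simp only [smul_eq_mul, Complex.real_smul, Real.norm_eq_abs, sq_abs]
    push_cast
    ring
  · simp only [hΦ, Complex.real_smul, smul_eq_mul]

theorem laplacianGraph_inner_im {ψ g : L2} (h : (ψ, g) ∈ laplacianGraph) :
    (inner ℂ ψ g).im = 0 := by
  rw [← Lp.inner_fourier_eq]
  exact inner_im_eq_zero_of_ae_eq_real_mul _ (laplacianGraph_fourier h)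

/-- The Hamiltonian is symmetric. -/
theorem hamiltonian_inner_im {t : ℝ} (ht : 0 < t)
    (ψ : (hamiltonian alpha beta gamma objective t).domain) :
    (inner ℂ (ψ : L2) (hamiltonian alpha beta gamma objective t ψ)).im = 0 := by
  obtain ⟨g₁, g₂, h₁, h₂, h⟩ := (eq_hamiltonian_iff ht ψ _).1 ⟨ψ.2, rfl⟩
  have e₁ : (-((t ^ 3)⁻¹ : ℂ)) = ((-(t ^ 3)⁻¹ : ℝ) : ℂ) := by push_cast; rfl
  have e₂ : (2 * (t : ℂ) ^ 3) = ((2 * t ^ 3 : ℝ) : ℂ) := by push_cast; rfl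
  erw [h]
  rw [inner_add_right, inner_smul_right, inner_smul_right, e₁, e₂, Complex.add_im,
    Complex.im_ofReal_mul, Complex.im_ofReal_mul, laplacianGraph_inner_im h₁,
    potentialGraph_inner_im h₂]
  simp

/-- For the difference `δ`, `i δ' = H δ` and `⟪δ, H δ⟫` is real, so `Re ⟪δ, δ'⟫ = 0`. At `t₀` only
continuity is available; the mean value theorem on `[t₀, T]` needs no more. -/
theorem IsSolution.eqOn {t₀ : ℝ} (ht₀ : 0 < t₀) {Ψ₀ : ℝ → ℂ} {Ψ Φ : ℝ → L2}
    (hΨ : IsSolution (hamiltonian alpha beta gamma objective) t₀ Ψ₀ Ψ)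
    (hΦ : IsSolution (hamiltonian alpha beta gamma objective) t₀ Ψ₀ Φ) :
    EqOn Ψ Φ (Ici t₀) := by
  have key : ∀ s > t₀, HasDerivAt (fun t => ‖Ψ t - Φ t‖ ^ 2) 0 s := by
    intro s hs
    obtain ⟨d₁, Ψ', hΨ', e₁⟩ := hΨ.equation s hs
    obtain ⟨d₂, Φ', hΦ', e₂⟩ := hΦ.equation s hs
    have hd := hΨ'.sub hΦ'
    have h := hamiltonian_inner_im (ht₀.trans hs) (⟨Ψ s, d₁⟩ - ⟨Φ s, d₂⟩)
    rw [LinearPMap.map_sub, ← e₁, ← e₂, ← smul_sub, inner_smul_right] at h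
    have hr : (inner ℂ (Ψ s - Φ s) (Ψ' - Φ')).re = 0 := by simpa using h
    have hn := hd.norm_sq
    -- The derivative of `‖δ‖²` involves the real inner product, which is the real part of the
    -- complex one.
    have hr' : inner ℝ (Ψ s - Φ s) (Ψ' - Φ') = 0 := by
      rw [← hr, L2.inner_def, L2.inner_def, ← RCLike.re_eq_complex_re,
        ← integral_re (L2.integrable_inner _ _)]
      rfl
    simpa [hr'] using hn
  have hcont : ContinuousOn (fun t => ‖Ψ t - Φ t‖ ^ 2) (Ici t₀) :=
    ((hΨ.continuousOn.sub hΦ.continuousOn).norm).pow 2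
  have h0 : Ψ t₀ = Φ t₀ := Lp.ext (hΨ.initial.trans hΦ.initial.symm)
  intro T hT
  have hT' : t₀ ≤ T := hT
  obtain rfl | hlt := hT'.eq_or_lt
  · exact h0
  obtain ⟨c, hc, e⟩ := exists_hasDerivAt_eq_slope (fun t => ‖Ψ t - Φ t‖ ^ 2) (fun _ => 0) hlt
    (hcont.mono Icc_subset_Ici_self) fun s hs => key s hs.1
  rw [eq_comm, div_eq_zero_iff] at e
  simp only [h0, sub_self, norm_zero] at e
  have h1 : ‖Ψ T - Φ T‖ ^ 2 = 0 := by
    rcases e with e | e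
    · simpa using e
    · linarith
  exact sub_eq_zero.1 (norm_eq_zero.1 (pow_eq_zero_iff two_ne_zero |>.1 h1))

/-! ### Global solutions of linear differential equations -/

section LinearODE

variable {E : Type*} [NormedAddCommGroup E] [NormedSpace ℝ E]

/-- Picard's integral operator, conjugated by the weight `exp (2 K (t - t₀))`. -/
noncomputable def weightedPicard (A : ℝ → E →L[ℝ] E) (K t₀ : ℝ) (y₀ : E) (z : ℝ → E) (t : ℝ) : E :=
  Real.exp (-(2 * K * (max t t₀ - t₀))) •
    (y₀ + ∫ s in t₀..max t t₀, A s (Real.exp (2 * K * (s - t₀)) • z s))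

/-- Integrating `K C exp (2 K (s - t₀))` produces the factor `C / 2`, and the weight cancels the
exponential: a contraction on the whole half-line at once. Allowing two initial values lets the
comparison with `0` also give boundedness. -/
theorem norm_weightedPicard_sub_le {A : ℝ → E →L[ℝ] E} (hA : Continuous A) {K : ℝ} (hK : 0 < K)
    (hAK : ∀ t, ‖A t‖ ≤ K) (t₀ : ℝ) (y₀ y₁ : E) {z w : ℝ → E} (hz : Continuous z)
    (hw : Continuous w) {C : ℝ} (hC : ∀ t, ‖z t - w t‖ ≤ C) (t : ℝ) :
    ‖weightedPicard A K t₀ y₀ z t - weightedPicard A K t₀ y₁ w t‖ ≤ ‖y₀ - y₁‖ + C / 2 := by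
  set m := max t t₀ with hm
  have htm : t₀ ≤ m := le_max_right _ _
  have hC0 : 0 ≤ C := (norm_nonneg _).trans (hC 0)
  have hi : ∀ v : ℝ → E, Continuous v → IntervalIntegrable
      (fun s => A s (Real.exp (2 * K * (s - t₀)) • v s)) volume t₀ m := fun v hv =>
    (hA.clm_apply (by fun_prop)).intervalIntegrable _ _
  have e : weightedPicard A K t₀ y₀ z t - weightedPicard A K t₀ y₁ w t =
      Real.exp (-(2 * K * (m - t₀))) • ((y₀ - y₁) +
        ∫ s in t₀..m, A s (Real.exp (2 * K * (s - t₀)) • (z s - w s))) := by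
    rw [weightedPicard, weightedPicard, ← hm, ← smul_sub, add_sub_add_comm,
      ← intervalIntegral.integral_sub (hi z hz) (hi w hw)]
    simp only [smul_sub, map_sub]
  have hd : ∀ s : ℝ, HasDerivAt (fun s => C / 2 * Real.exp (2 * K * (s - t₀)))
      (K * (Real.exp (2 * K * (s - t₀)) * C)) s := by
    intro s
    have h := ((((hasDerivAt_id s).sub_const t₀).const_mul (2 * K)).exp).const_mul (C / 2)
    exact h.congr_deriv (by simp only [id_eq]; ring)
  have hI : ‖∫ s in t₀..m, A s (Real.exp (2 * K * (s - t₀)) • (z s - w s))‖ ≤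
      C / 2 * Real.exp (2 * K * (m - t₀)) - C / 2 := by
    have h1 : ‖∫ s in t₀..m, A s (Real.exp (2 * K * (s - t₀)) • (z s - w s))‖ ≤
        ∫ s in t₀..m, K * (Real.exp (2 * K * (s - t₀)) * C) := by
      refine intervalIntegral.norm_integral_le_of_norm_le htm (ae_of_all _ fun s _ => ?_)
        (Continuous.intervalIntegrable (by fun_prop) _ _)
      refine (A s).le_of_opNorm_le_of_le (hAK s) ?_
      rw [norm_smul, Real.norm_eq_abs, abs_of_pos (Real.exp_pos _)]
      exact mul_le_mul_of_nonneg_left (hC s) (Real.exp_pos _).le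
    rw [intervalIntegral.integral_eq_sub_of_hasDerivAt (fun s _ => hd s)
      (Continuous.intervalIntegrable (by fun_prop) _ _)] at h1
    simpa using h1
  have hx : Real.exp (-(2 * K * (m - t₀))) ≤ 1 :=
    Real.exp_le_one_iff.2 (neg_nonpos.2 (mul_nonneg (by positivity) (sub_nonneg.2 htm)))
  have hxx : Real.exp (-(2 * K * (m - t₀))) * Real.exp (2 * K * (m - t₀)) = 1 := by
    rw [← Real.exp_add, neg_add_cancel, Real.exp_zero]
  rw [e, norm_smul, Real.norm_eq_abs, abs_of_pos (Real.exp_pos _)]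
  calc _ ≤ Real.exp (-(2 * K * (m - t₀))) *
        (‖y₀ - y₁‖ + (C / 2 * Real.exp (2 * K * (m - t₀)) - C / 2)) :=
        mul_le_mul_of_nonneg_left ((norm_add_le _ _).trans (by gcongr)) (Real.exp_pos _).le
    _ = Real.exp (-(2 * K * (m - t₀))) * ‖y₀ - y₁‖ +
        (Real.exp (-(2 * K * (m - t₀))) * Real.exp (2 * K * (m - t₀))) * (C / 2) -
        Real.exp (-(2 * K * (m - t₀))) * (C / 2) := by ring
    _ ≤ 1 * ‖y₀ - y₁‖ + 1 * (C / 2) - 0 := by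
        rw [hxx]
        gcongr
        positivity
    _ = _ := by ring

theorem continuous_weightedPicard {A : ℝ → E →L[ℝ] E} (hA : Continuous A) (K t₀ : ℝ) (y₀ : E)
    {z : ℝ → E} (hz : Continuous z) : Continuous (weightedPicard A K t₀ y₀ z) := by
  have h : Continuous fun t => ∫ s in t₀..t, A s (Real.exp (2 * K * (s - t₀)) • z s) :=
    intervalIntegral.continuous_primitive
      (fun a b => (hA.clm_apply (by fun_prop)).intervalIntegrable a b) t₀
  unfold weightedPicard
  have h2 := h.comp (continuous_id.max (continuous_const (y := t₀)))
  refine Continuous.smul (by fun_prop) (continuous_const.add h2)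

/-- A linear differential equation with bounded continuous coefficients has a global solution. -/
theorem exists_forall_ge_hasDerivAt_linear [CompleteSpace E] {A : ℝ → E →L[ℝ] E} (hA : Continuous A) {K : ℝ}
    (hAK : ∀ t, ‖A t‖ ≤ K) (t₀ : ℝ) (y₀ : E) :
    ∃ y : ℝ → E, y t₀ = y₀ ∧ ∀ t ≥ t₀, HasDerivAt y (A t (y t)) t := by
  obtain ⟨K, hK, hAK⟩ : ∃ K, 0 < K ∧ ∀ t, ‖A t‖ ≤ K :=
    ⟨max K 1, by positivity, fun t => (hAK t).trans (le_max_left _ _)⟩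
  have hb : ∀ z : ℝ →ᵇ E, ∀ t, ‖weightedPicard A K t₀ y₀ z t‖ ≤ ‖y₀‖ + ‖z‖ / 2 := by
    intro z t
    have h := norm_weightedPicard_sub_le hA hK hAK t₀ y₀ 0 z.continuous
      (continuous_const (y := (0 : E))) (fun s => by simpa using z.norm_coe_le_norm s) t
    simpa [weightedPicard] using h
  let T : (ℝ →ᵇ E) → (ℝ →ᵇ E) := fun z => BoundedContinuousFunction.ofNormedAddCommGroup
    (weightedPicard A K t₀ y₀ z) (continuous_weightedPicard hA K t₀ y₀ z.continuous) _ (hb z)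
  have hT : ContractingWith (1 / 2) T := by
    refine ⟨by rw [← NNReal.coe_lt_coe]; norm_num, LipschitzWith.of_dist_le_mul fun z w => ?_⟩
    refine (BoundedContinuousFunction.dist_le (by positivity)).2 fun t => ?_
    have h := norm_weightedPicard_sub_le hA hK hAK t₀ y₀ y₀ z.continuous w.continuous
      (fun s => (dist_eq_norm (z s) (w s)) ▸ z.dist_coe_le_dist s) t
    rw [dist_eq_norm]
    refine h.trans (le_of_eq ?_)
    simp
    ring
  obtain ⟨z, hz⟩ : ∃ z, T z = z := ⟨_, hT.fixedPoint_isFixedPt⟩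
  have hz' : ∀ t ≥ t₀, Real.exp (2 * K * (t - t₀)) • z t =
      y₀ + ∫ s in t₀..t, A s (Real.exp (2 * K * (s - t₀)) • z s) := by
    intro t ht
    have h : z t = weightedPicard A K t₀ y₀ z t := by exact (DFunLike.congr_fun hz t).symm
    rw [h, weightedPicard, max_eq_left ht, smul_smul, ← Real.exp_add, add_neg_cancel,
      Real.exp_zero, one_smul]
  -- The unclipped integral is taken as the solution, so that it has a two-sided derivative even at
  -- `t₀`.
  refine ⟨fun t => y₀ + ∫ s in t₀..t, A s (Real.exp (2 * K * (s - t₀)) • z s), by simp,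
    fun t ht => ?_⟩
  have hc : Continuous fun s => A s (Real.exp (2 * K * (s - t₀)) • z s) :=
    hA.clm_apply (by fun_prop)
  change HasDerivAt _ (A t (y₀ + ∫ s in t₀..t, A s (Real.exp (2 * K * (s - t₀)) • z s))) t
  rw [← hz' t ht]
  exact (hc.integral_hasStrictDerivAt t₀ t).hasDerivAt.const_add y₀

end LinearODE

/-! ### The damped oscillator -/

/-- `p` solves `p'' + (3 / t) p' + 4 p = 0` on `[t₀, ∞)`, with derivative `p'`. -/
def IsClassicalSolution (t₀ : ℝ) (p p' : ℝ → ℝ) : Prop :=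
  ∀ t ≥ t₀, HasDerivAt p (p' t) t ∧ HasDerivAt p' (-4 * p t - 3 / t * p' t) t

theorem exists_isClassicalSolution {t₀ : ℝ} (ht₀ : 0 < t₀) (x y : ℝ) :
    ∃ p p' : ℝ → ℝ, p t₀ = x ∧ p' t₀ = y ∧ IsClassicalSolution t₀ p p' := by
  -- Replacing `t` by `max t t₀` keeps the coefficient `3 / t` continuous and bounded on all of `ℝ`.
  let A : ℝ → (ℝ × ℝ) →L[ℝ] (ℝ × ℝ) := fun t =>
    (ContinuousLinearMap.snd ℝ ℝ ℝ).prod ((-4 : ℝ) • ContinuousLinearMap.fst ℝ ℝ ℝ) -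
      (3 / max t t₀) • (ContinuousLinearMap.inr ℝ ℝ ℝ ∘L ContinuousLinearMap.snd ℝ ℝ ℝ)
  have hAv : ∀ t v, A t v = (v.2, -4 * v.1 - 3 / max t t₀ * v.2) := fun t v => by
    ext <;> simp [A]
  have hpos : ∀ t, 0 < max t t₀ := fun t => lt_max_of_lt_right ht₀
  have hA : Continuous A := by
    have h : Continuous fun t => 3 / max t t₀ :=
      continuous_const.div (by fun_prop) fun t => (hpos t).ne'
    exact continuous_const.sub (h.smul continuous_const)
  have hAK : ∀ t, ‖A t‖ ≤ 4 + 3 / t₀ := by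
    intro t
    have h3 : 3 / max t t₀ ≤ 3 / t₀ := by gcongr; exact le_max_right _ _
    have h30 : 0 ≤ 3 / max t t₀ := (div_pos three_pos (hpos t)).le
    refine ContinuousLinearMap.opNorm_le_bound _ (by positivity) fun v => ?_
    have h1 := norm_fst_le v
    have h2 := norm_snd_le v
    rw [hAv]
    refine max_le ?_ ?_
    · change ‖v.2‖ ≤ _
      nlinarith [norm_nonneg v]
    · change ‖(-4 : ℝ) * v.1 - 3 / max t t₀ * v.2‖ ≤ _
      refine (norm_sub_le _ _).trans ?_
      rw [norm_mul, norm_mul, norm_neg, Real.norm_of_nonneg h30, Real.norm_of_nonneg zero_le_four,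
        add_mul]
      gcongr
  obtain ⟨y', h0, hy⟩ := exists_forall_ge_hasDerivAt_linear hA hAK t₀ (x, y)
  refine ⟨fun t => (y' t).1, fun t => (y' t).2, by simp [h0], by simp [h0], fun t ht => ⟨?_, ?_⟩⟩
  · have h := (ContinuousLinearMap.fst ℝ ℝ ℝ).hasFDerivAt.comp_hasDerivAt t (hy t ht)
    rwa [hAv] at h
  · have h := (ContinuousLinearMap.snd ℝ ℝ ℝ).hasFDerivAt.comp_hasDerivAt t (hy t ht)
    rwa [hAv, max_eq_left ht] at h

theorem eq_of_hasDerivAt_zero {F : Type*} [NormedAddCommGroup F] [NormedSpace ℝ F] {t₀ : ℝ}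
    {f : ℝ → F} (h : ∀ t ≥ t₀, HasDerivAt f 0 t) {t : ℝ} (ht : t₀ ≤ t) : f t = f t₀ :=
  constant_of_has_deriv_right_zero
    (fun s hs => (h s hs.1).continuousAt.continuousWithinAt)
    (fun s hs => (h s hs.1).hasDerivWithinAt) t ⟨ht, le_rfl⟩

/-- The Wronskian of two solutions is a multiple of `t⁻³`. -/
theorem IsClassicalSolution.wronskian {t₀ : ℝ} (ht₀ : 0 < t₀) {p p' q q' : ℝ → ℝ}
    (hp : IsClassicalSolution t₀ p p') (hq : IsClassicalSolution t₀ q q') {t : ℝ} (ht : t₀ ≤ t) :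
    t ^ 3 * (p t * q' t - q t * p' t) = t₀ ^ 3 * (p t₀ * q' t₀ - q t₀ * p' t₀) := by
  refine eq_of_hasDerivAt_zero (f := fun t => t ^ 3 * (p t * q' t - q t * p' t)) (fun s hs => ?_) ht
  obtain ⟨p1, p2⟩ := hp s hs
  obtain ⟨q1, q2⟩ := hq s hs
  have hs0 : s ≠ 0 := (ht₀.trans_le hs).ne'
  refine ((hasDerivAt_pow 3 s).mul ((p1.mul q2).sub (q1.mul p2))).congr_deriv ?_
  simp only [Pi.mul_apply, Pi.sub_apply]
  field_simp
  push_cast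
  ring

/-- The energy of a solution decays like `t⁻³`. -/
theorem IsClassicalSolution.exists_energy_le {t₀ : ℝ} {p p' : ℝ → ℝ}
    (hp : IsClassicalSolution t₀ p p') :
    ∃ M T : ℝ, ∀ t ≥ T, t ^ 3 * (p' t ^ 2 + 4 * p t ^ 2) ≤ M := by
  -- The weighted energy alone has derivative `3 t² (4 p² - p'²)`; the correction `3 t² p p'`
  -- cancels this and leaves only `-3 t p p'`.
  let Q : ℝ → ℝ := fun t => t ^ 3 * (p' t ^ 2 + 4 * p t ^ 2) + 3 * t ^ 2 * (p t * p' t)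
  set T := max t₀ 2
  have hT0 : ∀ t ≥ T, t₀ ≤ t := fun t ht => (le_max_left _ _).trans ht
  have hT2 : ∀ t ≥ T, 2 ≤ t := fun t ht => (le_max_right _ _).trans ht
  have hQ : ∀ t ≥ T, HasDerivAt Q (-3 * t * (p t * p' t)) t := by
    intro t ht
    obtain ⟨p1, p2⟩ := hp t (hT0 t ht)
    have ht0 : t ≠ 0 := by linarith [hT2 t ht]
    refine (((hasDerivAt_pow 3 t).mul ((p2.pow 2).add ((p1.pow 2).const_mul 4))).add
      (((hasDerivAt_pow 2 t).const_mul 3).mul (p1.mul p2))).congr_deriv ?_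
    simp only [Pi.mul_apply, Pi.add_apply, Pi.pow_apply]
    field_simp
    push_cast
    ring
  have habs : ∀ t, |p t * p' t| ≤ (p' t ^ 2 + 4 * p t ^ 2) / 4 := fun t => by
    rw [abs_le]
    constructor <;> nlinarith [sq_nonneg (p' t + 2 * p t), sq_nonneg (p' t - 2 * p t)]
  -- The correction is at most `3 / (4 t)` times the weighted energy, hence at most `3 / 8` of it
  -- once `t ≥ 2`.
  have hPQ : ∀ t ≥ T, t ^ 3 * (p' t ^ 2 + 4 * p t ^ 2) ≤ 2 * Q t := by
    intro t ht
    have h2 := hT2 t ht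
    have h := (abs_le.1 (habs t)).1
    have h3 : 0 ≤ t ^ 2 * (p' t ^ 2 + 4 * p t ^ 2) := by positivity
    have h4 : 3 * t ^ 2 * (-((p' t ^ 2 + 4 * p t ^ 2) / 4)) ≤ 3 * t ^ 2 * (p t * p' t) := by gcongr
    have h5 : 2 * (t ^ 2 * (p' t ^ 2 + 4 * p t ^ 2)) ≤ t * (t ^ 2 * (p' t ^ 2 + 4 * p t ^ 2)) := by
      gcongr
    simp only [Q]
    nlinarith
  -- Since `Q' ≤ (3/2) t⁻² Q`, the bounded integrating factor `exp (3 / (2 t))` makes the product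
  -- decrease.
  have hanti : AntitoneOn (fun t => Q t * Real.exp (3 / 2 * t⁻¹)) (Ici T) := by
    have hd : ∀ t ≥ T, HasDerivAt (fun t => Q t * Real.exp (3 / 2 * t⁻¹))
        (-3 * t * (p t * p' t) * Real.exp (3 / 2 * t⁻¹) +
          Q t * (Real.exp (3 / 2 * t⁻¹) * (3 / 2 * -(t ^ 2)⁻¹))) t := fun t ht =>
      (hQ t ht).mul (((hasDerivAt_inv (by linarith [hT2 t ht])).const_mul (3 / 2)).exp)
    refine antitoneOn_of_hasDerivWithinAt_nonpos (convex_Ici T)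
      (fun t ht => (hd t ht).continuousAt.continuousWithinAt)
      (fun t ht => (hd t (interior_subset ht)).hasDerivWithinAt) fun t ht => ?_
    have ht' : T ≤ t := interior_subset ht
    have h0 : 0 < t := by linarith [hT2 t ht']
    have h := (abs_le.1 (habs t)).1
    have h2 := hPQ t ht'
    have h3 : -3 * t * (p t * p' t) ≤ 3 / 2 * (t ^ 2)⁻¹ * Q t := by
      calc -3 * t * (p t * p' t) = 3 * t * (-(p t * p' t)) := by ring
        _ ≤ 3 * t * ((p' t ^ 2 + 4 * p t ^ 2) / 4) := by gcongr; linarith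
        _ = 3 / 4 * (t ^ 2)⁻¹ * (t ^ 3 * (p' t ^ 2 + 4 * p t ^ 2)) := by field_simp
        _ ≤ 3 / 4 * (t ^ 2)⁻¹ * (2 * Q t) := by gcongr
        _ = _ := by ring
    have h4 := mul_le_mul_of_nonneg_right h3 (Real.exp_pos (3 / 2 * t⁻¹)).le
    linarith
  refine ⟨2 * (Q T * Real.exp (3 / 2 * T⁻¹)), T, fun t ht => (hPQ t ht).trans ?_⟩
  have h := hanti self_mem_Ici ht ht
  have h0 : 0 < t := by linarith [hT2 t ht]
  have hQ0 : 0 ≤ Q t := by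
    have : 0 ≤ t ^ 3 * (p' t ^ 2 + 4 * p t ^ 2) := by positivity
    linarith [hPQ t ht]
  have h1 : 1 ≤ Real.exp (3 / 2 * t⁻¹) := Real.one_le_exp (by positivity)
  dsimp only at h
  nlinarith

/-- If the Wronskian does not vanish, then `p² + q²` is of exact order `t⁻³`. -/
theorem IsClassicalSolution.isTheta {t₀ : ℝ} (ht₀ : 0 < t₀) {p p' q q' : ℝ → ℝ}
    (hp : IsClassicalSolution t₀ p p') (hq : IsClassicalSolution t₀ q q')
    (hw : t₀ ^ 3 * (p t₀ * q' t₀ - q t₀ * p' t₀) = 1) :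
    (fun t => p t ^ 2 + q t ^ 2) =Θ[atTop] fun t => t ^ (-3 : ℤ) := by
  obtain ⟨M, T, hM⟩ := hp.exists_energy_le
  obtain ⟨N, S, hN⟩ := hq.exists_energy_le
  have hev : ∀ᶠ t in atTop, t₀ ≤ t ∧ t ^ 3 * (p' t ^ 2 + 4 * p t ^ 2) ≤ M ∧
      t ^ 3 * (q' t ^ 2 + 4 * q t ^ 2) ≤ N := by
    filter_upwards [eventually_ge_atTop T, eventually_ge_atTop S, eventually_ge_atTop t₀]
      with t h1 h2 h3 using ⟨h3, hM t h1, hN t h2⟩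
  constructor
  · refine IsBigO.of_bound (M + N) ?_
    filter_upwards [hev] with t ⟨ht, h1, h2⟩
    have h0 : 0 < t := ht₀.trans_le ht
    rw [Real.norm_of_nonneg (by positivity), Real.norm_of_nonneg (by positivity), zpow_neg,
      ← div_eq_mul_inv, le_div_iff₀ (by positivity)]
    norm_cast
    have h3 : 0 ≤ t ^ 3 * (p' t ^ 2 + q' t ^ 2 + 3 * p t ^ 2 + 3 * q t ^ 2) := by positivity
    nlinarith
  · refine IsBigO.of_bound (M + N) ?_
    filter_upwards [hev] with t ⟨ht, h1, h2⟩
    have h0 : 0 < t := ht₀.trans_le ht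
    rw [Real.norm_of_nonneg (by positivity), Real.norm_of_nonneg (by positivity), zpow_neg,
      inv_le_iff_one_le_mul₀ (by positivity)]
    norm_cast
    have hW := (hp.wronskian ht₀ hq ht).trans hw
    -- Lagrange's identity: the two sides differ by `(p p' + q q')²`.
    have hcs : (p t * q' t - q t * p' t) ^ 2 ≤ (p t ^ 2 + q t ^ 2) * (p' t ^ 2 + q' t ^ 2) := by
      nlinarith [sq_nonneg (p t * p' t + q t * q' t)]
    have h3 : t ^ 3 * (p' t ^ 2 + q' t ^ 2) ≤ M + N := by
      have : 0 ≤ t ^ 3 * (4 * p t ^ 2 + 4 * q t ^ 2) := by positivity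
      nlinarith
    calc (1 : ℝ) = (t ^ 3 * (p t * q' t - q t * p' t)) ^ 2 := by rw [hW, one_pow]
      _ = t ^ 3 * t ^ 3 * (p t * q' t - q t * p' t) ^ 2 := by ring
      _ ≤ t ^ 3 * t ^ 3 * ((p t ^ 2 + q t ^ 2) * (p' t ^ 2 + q' t ^ 2)) := by gcongr
      _ = t ^ 3 * (p' t ^ 2 + q' t ^ 2) * (p t ^ 2 + q t ^ 2) * t ^ 3 := by ring
      _ ≤ (M + N) * (p t ^ 2 + q t ^ 2) * t ^ 3 := by gcongr

/-! ### Gaussians in `L²` -/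

/-- The function `xⁿ exp (-b x² / 2)`. -/
noncomputable def monomialGaussian (n : ℕ) (b : ℂ) (x : ℝ) : ℂ :=
  (x : ℂ) ^ n * Complex.exp (-b * (x : ℂ) ^ 2 / 2)

theorem norm_monomialGaussian (n : ℕ) (b : ℂ) (x : ℝ) :
    ‖monomialGaussian n b x‖ = |x| ^ n * Real.exp (-b.re * x ^ 2 / 2) := by
  rw [monomialGaussian, norm_mul, norm_pow, Complex.norm_real, Real.norm_eq_abs, Complex.norm_exp]
  congr 2
  rw [← Complex.ofReal_pow, show (2 : ℂ) = ((2 : ℝ) : ℂ) by norm_num, Complex.div_ofReal_re,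
    Complex.re_mul_ofReal, Complex.neg_re]

theorem norm_monomialGaussian_sq (n : ℕ) (b : ℂ) (x : ℝ) :
    ‖monomialGaussian n b x‖ ^ 2 = x ^ (2 * n) * Real.exp (-b.re * x ^ 2) := by
  rw [norm_monomialGaussian, mul_pow, ← pow_mul, mul_comm n 2, pow_mul, sq_abs, ← pow_mul,
    ← Real.exp_nat_mul]
  congr 2
  push_cast
  ring

theorem integrable_pow_mul_exp_neg_mul_sq (n : ℕ) {c : ℝ} (hc : 0 < c) :
    Integrable fun x : ℝ => x ^ n * Real.exp (-c * x ^ 2) := by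
  simpa using integrable_rpow_mul_exp_neg_mul_sq hc
    (show (-1 : ℝ) < n by linarith [n.cast_nonneg (α := ℝ)])

theorem memLp_monomialGaussian (n : ℕ) {b : ℂ} (hb : 0 < b.re) :
    MemLp (monomialGaussian n b) 2 := by
  have hc : Continuous (monomialGaussian n b) := by
    unfold monomialGaussian
    fun_prop
  rw [memLp_two_iff_integrable_sq_norm hc.aestronglyMeasurable]
  simp only [norm_monomialGaussian_sq]
  exact integrable_pow_mul_exp_neg_mul_sq _ hb

open Classical in
/-- The function `xⁿ exp (-b x² / 2)` as an element of `L²`; zero if it is not square integrable. -/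
noncomputable def gaussianL2 (n : ℕ) (b : ℂ) : L2 :=
  if h : MemLp (monomialGaussian n b) 2 then h.toLp else 0

theorem coeFn_gaussianL2 (n : ℕ) {b : ℂ} (hb : 0 < b.re) :
    gaussianL2 n b =ᵐ[volume] monomialGaussian n b := by
  rw [gaussianL2, dif_pos (memLp_monomialGaussian n hb)]
  exact MemLp.coeFn_toLp _

/-- With `w = -(z - b) x² / 2`, the first-order Taylor remainder is `e^w - 1 - w`, bounded by `|w|²
e^|w|`. For `|z - b| < Re b / 2` the factor `e^|w|` uses up at most half of the Gaussian decay, so a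
fixed function in `L²` times `|z - b|²` dominates. -/
theorem hasDerivAt_gaussianL2 {b : ℂ} (hb : 0 < b.re) :
    HasDerivAt (gaussianL2 0) (-(1 / 2 : ℂ) • gaussianL2 2 b) b := by
  rw [hasDerivAt_iff_isLittleO]
  have hO : (fun z => gaussianL2 0 z - gaussianL2 0 b - (z - b) • (-(1 / 2 : ℂ) • gaussianL2 2 b))
      =O[𝓝 b] fun z => ‖z - b‖ ^ 2 := by
    refine IsBigO.of_bound ‖gaussianL2 4 ((b.re / 2 : ℝ) : ℂ)‖ ?_
    filter_upwards [Metric.ball_mem_nhds b (half_pos hb)] with z hz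
    rw [Metric.mem_ball, dist_eq_norm] at hz
    have hzre : 0 < z.re := by
      have := (abs_le.1 (Complex.abs_re_le_norm (z - b))).1
      rw [Complex.sub_re] at this
      linarith
    rw [mul_comm, norm_pow, norm_norm]
    refine Lp.norm_le_mul_norm_of_ae_le_mul ?_
    have hb2 : 0 < ((b.re / 2 : ℝ) : ℂ).re := by rw [Complex.ofReal_re]; linarith
    filter_upwards [coeFn_gaussianL2 0 hzre, coeFn_gaussianL2 0 hb, coeFn_gaussianL2 2 hb,
      coeFn_gaussianL2 4 hb2, Lp.coeFn_sub (gaussianL2 0 z) (gaussianL2 0 b),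
      Lp.coeFn_sub (gaussianL2 0 z - gaussianL2 0 b) ((z - b) • (-(1 / 2 : ℂ) • gaussianL2 2 b)),
      Lp.coeFn_smul (z - b) (-(1 / 2 : ℂ) • gaussianL2 2 b),
      Lp.coeFn_smul (-(1 / 2 : ℂ)) (gaussianL2 2 b)] with x h1 h2 h3 h4 h5 h6 h7 h8
    rw [h6, Pi.sub_apply, h5, Pi.sub_apply, h7, Pi.smul_apply, h8, Pi.smul_apply, h1, h2, h3, h4,
      norm_monomialGaussian 4]
    set w : ℂ := -(z - b) * (x : ℂ) ^ 2 / 2 with hw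
    have hwn : ‖w‖ = ‖z - b‖ * x ^ 2 / 2 := by
      rw [hw, norm_div, norm_mul, norm_neg, norm_pow, Complex.norm_real, Real.norm_eq_abs, sq_abs]
      norm_num
    have hE : monomialGaussian 0 z x - monomialGaussian 0 b x -
        (z - b) • (-(1 / 2 : ℂ)) • monomialGaussian 2 b x =
        monomialGaussian 0 b x * (Complex.exp w - ∑ m ∈ Finset.range 2, w ^ m / m.factorial) := by
      have : monomialGaussian 0 z x = monomialGaussian 0 b x * Complex.exp w := by
        simp only [monomialGaussian, pow_zero, one_mul, ← Complex.exp_add, hw]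
        congr 1
        ring
      rw [this]
      simp only [monomialGaussian, Finset.sum_range_succ, Finset.sum_range_zero, smul_eq_mul, hw]
      simp
      ring
    rw [hE, norm_mul, norm_monomialGaussian, pow_zero, one_mul]
    have h9 := Complex.norm_exp_sub_sum_le_norm_mul_exp w 2
    have hx4 : |x| ^ 4 = x ^ 4 := by rw [show 4 = 2 * 2 from rfl, pow_mul, sq_abs, ← pow_mul]
    have hexp : Real.exp (-b.re * x ^ 2 / 2) * Real.exp ‖w‖ ≤
        Real.exp (-((b.re / 2 : ℝ) : ℂ).re * x ^ 2 / 2) := by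
      rw [← Real.exp_add, hwn, Complex.ofReal_re]
      refine Real.exp_le_exp.2 ?_
      have : ‖z - b‖ * x ^ 2 ≤ b.re / 2 * x ^ 2 := by gcongr
      linarith
    calc _ ≤ Real.exp (-b.re * x ^ 2 / 2) * (‖w‖ ^ 2 * Real.exp ‖w‖) := by gcongr
      _ = ‖w‖ ^ 2 * (Real.exp (-b.re * x ^ 2 / 2) * Real.exp ‖w‖) := by ring
      _ ≤ ‖w‖ ^ 2 * Real.exp (-((b.re / 2 : ℝ) : ℂ).re * x ^ 2 / 2) := by gcongr
      _ ≤ (‖z - b‖ ^ 2 * |x| ^ 4) * Real.exp (-((b.re / 2 : ℝ) : ℂ).re * x ^ 2 / 2) := by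
        gcongr
        rw [hwn, hx4]
        nlinarith [sq_nonneg (‖z - b‖ * x ^ 2)]
      _ = _ := by ring
  refine hO.trans_isLittleO ?_
  have h : Tendsto (fun z : ℂ => z - b) (𝓝 b) (𝓝 0) := by
    have : Continuous fun z : ℂ => z - b := by fun_prop
    simpa using this.tendsto b
  have h2 := (isLittleO_norm_pow_id (E' := ℂ) one_lt_two).comp_tendsto h
  exact h2

theorem hasDerivAt_monomialGaussian_zero (b : ℂ) (x : ℝ) :
    HasDerivAt (monomialGaussian 0 b) (-b * monomialGaussian 1 b x) x := by
  have h : HasDerivAt (fun x : ℝ => -b * (x : ℂ) ^ 2 / 2) (-b * (2 * x) / 2) x := by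
    have := (((hasDerivAt_id x).ofReal_comp.pow 2).const_mul (-b)).div_const 2
    refine this.congr_deriv ?_
    simp
  have h2 := h.cexp
  unfold monomialGaussian
  simp only [pow_zero, one_mul]
  refine h2.congr_deriv ?_
  ring

theorem hasDerivAt_monomialGaussian_one (b : ℂ) (x : ℝ) :
    HasDerivAt (monomialGaussian 1 b) (monomialGaussian 0 b x - b * monomialGaussian 2 b x) x := by
  have h := (hasDerivAt_id x).ofReal_comp.mul (hasDerivAt_monomialGaussian_zero b x)
  have e : monomialGaussian 1 b = (fun y : ℝ => ((id y : ℝ) : ℂ)) * monomialGaussian 0 b := by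
    ext y
    simp [monomialGaussian]
  rw [e]
  refine h.congr_deriv ?_
  simp [monomialGaussian]
  ring

/-- Two integrations by parts move both derivatives from the Schwartz test function to the Gaussian.
-/
theorem gaussianL2_mem_laplacianGraph {b : ℂ} (hb : 0 < b.re) :
    (gaussianL2 0 b, b ^ 2 • gaussianL2 2 b - b • gaussianL2 0 b) ∈ laplacianGraph := by
  change Δ (gaussianL2 0 b : 𝓢'(ℝ, ℂ)) =
    ((b ^ 2 • gaussianL2 2 b - b • gaussianL2 0 b : L2) : 𝓢'(ℝ, ℂ))
  ext φ
  rw [TemperedDistribution.laplacian_apply_apply, Lp.toTemperedDistribution_apply,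
    Lp.toTemperedDistribution_apply]
  set φ' := SchwartzMap.derivCLM ℂ ℂ φ with hφ'
  set φ'' := SchwartzMap.derivCLM ℂ ℂ φ' with hφ''
  have d1 : ∀ x, HasDerivAt φ (φ' x) x := fun x => φ.differentiable.differentiableAt.hasDerivAt
  have d2 : ∀ x, HasDerivAt φ' (φ'' x) x := fun x => φ'.differentiable.differentiableAt.hasDerivAt
  have hΔ : ∀ x, Δ φ x = φ'' x := by
    intro x
    rw [SchwartzMap.laplacian_apply, InnerProductSpace.laplacian_eq_iteratedDeriv_real,
      iteratedDeriv_succ, iteratedDeriv_one, (funext fun x => (d1 x).deriv : deriv φ = φ'),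
      (d2 x).deriv]
  have hm : ∀ (n : ℕ) (f : 𝓢(ℝ, ℂ)), Integrable (⇑f * monomialGaussian n b) := fun n f =>
    (f.memLp 2).integrable_mul (memLp_monomialGaussian n hb)
  have i1 : ∫ x, monomialGaussian 0 b x * φ'' x = -∫ x, -b * monomialGaussian 1 b x * φ' x := by
    refine integral_mul_deriv_eq_deriv_mul_of_integrable
      (fun x _ => hasDerivAt_monomialGaussian_zero b x) (fun x _ => d2 x) ?_ ?_ ?_
    · rw [mul_comm]; exact hm 0 φ''
    · refine ((hm 1 φ').const_mul (-b)).congr (ae_of_all _ fun x => ?_)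
      simp only [Pi.mul_apply]; ring
    · rw [mul_comm]; exact hm 0 φ'
  have i2 : ∫ x, monomialGaussian 1 b x * φ' x =
      -∫ x, (monomialGaussian 0 b x - b * monomialGaussian 2 b x) * φ x := by
    refine integral_mul_deriv_eq_deriv_mul_of_integrable
      (fun x _ => hasDerivAt_monomialGaussian_one b x) (fun x _ => d1 x) ?_ ?_ ?_
    · rw [mul_comm]; exact hm 1 φ'
    · refine ((hm 0 φ).sub ((hm 2 φ).const_mul b)).congr (ae_of_all _ fun x => ?_)
      simp only [Pi.mul_apply, Pi.sub_apply]; ring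
    · rw [mul_comm]; exact hm 1 φ
  calc ∫ x, Δ φ x • gaussianL2 0 b x = ∫ x, monomialGaussian 0 b x * φ'' x := by
        refine integral_congr_ae ?_
        filter_upwards [coeFn_gaussianL2 0 hb] with x hx
        rw [hx, hΔ, smul_eq_mul, mul_comm]
    _ = ∫ x, -b * ((monomialGaussian 0 b x - b * monomialGaussian 2 b x) * φ x) := by
        simp only [i1, mul_assoc, integral_const_mul, i2]
        ring
    _ = _ := by
        refine integral_congr_ae ?_
        filter_upwards [coeFn_gaussianL2 0 hb, coeFn_gaussianL2 2 hb,
          Lp.coeFn_sub (b ^ 2 • gaussianL2 2 b) (b • gaussianL2 0 b),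
          Lp.coeFn_smul (b ^ 2) (gaussianL2 2 b), Lp.coeFn_smul b (gaussianL2 0 b)]
          with x h1 h2 h3 h4 h5
        rw [h3, Pi.sub_apply, h4, h5, Pi.smul_apply, Pi.smul_apply, h1, h2]
        simp only [smul_eq_mul]
        ring

theorem gaussianL2_mem_potentialGraph {b : ℂ} (hb : 0 < b.re) :
    (gaussianL2 0 b, (1 / 2 : ℂ) • gaussianL2 2 b) ∈ potentialGraph objective := by
  change (fun x => (objective x : ℂ) * gaussianL2 0 b x) =ᵐ[volume] _
  filter_upwards [coeFn_gaussianL2 0 hb, coeFn_gaussianL2 2 hb,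
    Lp.coeFn_smul (1 / 2 : ℂ) (gaussianL2 2 b)] with x h1 h2 h3
  rw [h3, Pi.smul_apply, h1, h2]
  simp only [monomialGaussian, objective, smul_eq_mul]
  push_cast
  ring

/-- Substitution of `√c x`. Only the power of `c` matters later; the remaining integral need only be
positive. -/
theorem integral_sq_mul_exp_neg_mul_sq {c : ℝ} (hc : 0 < c) :
    ∫ x : ℝ, x ^ 2 * Real.exp (-c * x ^ 2) =
      c⁻¹ * (√c)⁻¹ * ∫ x : ℝ, x ^ 2 * Real.exp (-1 * x ^ 2) := by
  have hs := Real.sq_sqrt hc.le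
  have h := Measure.integral_comp_mul_left (fun x : ℝ => x ^ 2 * Real.exp (-1 * x ^ 2)) (√c)
  have e : ∀ x : ℝ, (√c * x) ^ 2 * Real.exp (-1 * (√c * x) ^ 2) =
      c * (x ^ 2 * Real.exp (-c * x ^ 2)) := fun x => by
    rw [mul_pow, hs, mul_assoc, neg_one_mul, neg_mul]
  simp only [e, integral_const_mul] at h
  rw [mul_assoc, eq_inv_mul_iff_mul_eq₀ hc.ne', h, smul_eq_mul,
    abs_of_nonneg (inv_nonneg.2 (Real.sqrt_nonneg c))]

theorem integral_sq_mul_exp_neg_sq_pos : 0 < ∫ x : ℝ, x ^ 2 * Real.exp (-1 * x ^ 2) := by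
  refine integral_pos_of_integrable_nonneg_nonzero (x := 1) (by fun_prop)
    (integrable_pow_mul_exp_neg_mul_sq 2 one_pos) (fun x => by positivity) (by positivity)

/-! ### The Gaussian ansatz and its parameters -/

/-- The wave function `exp (a - b x² / 2)` in `L²`. -/
noncomputable def gaussianWave (a b : ℂ) : L2 := Complex.exp a • gaussianL2 0 b

theorem coeFn_gaussianWave (a : ℂ) {b : ℂ} (hb : 0 < b.re) :
    gaussianWave a b =ᵐ[volume] fun x => Complex.exp a * monomialGaussian 0 b x := by
  filter_upwards [Lp.coeFn_smul (Complex.exp a) (gaussianL2 0 b), coeFn_gaussianL2 0 hb]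
    with x h1 h2
  rw [gaussianWave, h1, Pi.smul_apply, h2, smul_eq_mul]

theorem objective_mul_norm_gaussianWave_sq (a : ℂ) {b : ℂ} (hb : 0 < b.re) :
    (fun x => objective x * ‖gaussianWave a b x‖ ^ 2) =ᵐ[volume]
      fun x => ‖Complex.exp a‖ ^ 2 / 2 * (x ^ 2 * Real.exp (-b.re * x ^ 2)) := by
  filter_upwards [coeFn_gaussianWave a hb] with x hx
  rw [hx, norm_mul, mul_pow, norm_monomialGaussian_sq, objective]
  simp only [mul_zero, pow_zero, one_mul]
  ring

theorem integrable_objective_gaussianWave (a : ℂ) {b : ℂ} (hb : 0 < b.re) :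
    Integrable fun x => objective x * ‖gaussianWave a b x‖ ^ 2 :=
  ((integrable_pow_mul_exp_neg_mul_sq 2 hb).const_mul _).congr
    (objective_mul_norm_gaussianWave_sq a hb).symm

theorem expectation_gaussianWave (a : ℂ) {b : ℂ} (hb : 0 < b.re) :
    expectation objective (gaussianWave a b) = ‖Complex.exp a‖ ^ 2 / 2 *
      (b.re⁻¹ * (√b.re)⁻¹ * ∫ x : ℝ, x ^ 2 * Real.exp (-1 * x ^ 2)) := by
  rw [expectation, integral_congr_ae (objective_mul_norm_gaussianWave_sq a hb),
    integral_const_mul, integral_sq_mul_exp_neg_mul_sq hb]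

theorem smul_mk_mem {S : Submodule ℂ (L2 × L2)} (c : ℂ) {ψ g : L2} (h : (ψ, g) ∈ S) :
    (c • ψ, c • g) ∈ S :=
  S.smul_mem c h

/-- The ansatz `exp (a_t - b_t x² / 2)` solves the Schrödinger equation if `b` solves the Riccati
equation and `a` the corresponding transport equation. -/
theorem isSolution_gaussianWave {t₀ : ℝ} (ht₀ : 0 < t₀) {Ψ₀ : ℝ → ℂ} {a b : ℝ → ℂ}
    (hb : ∀ t ≥ t₀, 0 < (b t).re)
    (ha' : ∀ t ≥ t₀, HasDerivAt a (-Complex.I * ((t : ℂ) ^ 3)⁻¹ * b t) t)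
    (hb' : ∀ t ≥ t₀,
      HasDerivAt b (2 * Complex.I * ((t : ℂ) ^ 3 - ((t : ℂ) ^ 3)⁻¹ * b t ^ 2)) t)
    (h0 : gaussianWave (a t₀) (b t₀) =ᵐ[volume] Ψ₀) :
    IsSolution (hamiltonian alpha beta gamma objective) t₀ Ψ₀
      fun t => gaussianWave (a t) (b t) := by
  have hd : ∀ t ≥ t₀, HasDerivAt (fun t => gaussianWave (a t) (b t))
      (Complex.exp (a t) • ((2 * Complex.I * ((t : ℂ) ^ 3 - ((t : ℂ) ^ 3)⁻¹ * b t ^ 2)) •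
        (-(1 / 2 : ℂ)) • gaussianL2 2 (b t)) +
      (Complex.exp (a t) * (-Complex.I * ((t : ℂ) ^ 3)⁻¹ * b t)) • gaussianL2 0 (b t)) t :=
    fun t ht => (ha' t ht).cexp.smul ((hasDerivAt_gaussianL2 (hb t ht)).scomp t (hb' t ht))
  refine ⟨fun t ht => (hd t ht).continuousAt.continuousWithinAt, h0, fun t ht => ?_⟩
  have hbt := hb t ht.le
  have hL : (gaussianWave (a t) (b t), Complex.exp (a t) •
      (b t ^ 2 • gaussianL2 2 (b t) - b t • gaussianL2 0 (b t))) ∈ laplacianGraph :=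
    smul_mk_mem (Complex.exp (a t)) (gaussianL2_mem_laplacianGraph hbt)
  have hV : (gaussianWave (a t) (b t), Complex.exp (a t) • (1 / 2 : ℂ) • gaussianL2 2 (b t)) ∈
      potentialGraph objective :=
    smul_mk_mem (Complex.exp (a t)) (gaussianL2_mem_potentialGraph hbt)
  obtain ⟨hdom, e⟩ := (eq_hamiltonian_iff (ht₀.trans ht) (gaussianWave (a t) (b t)) _).2
    ⟨_, _, hL, hV, rfl⟩
  refine ⟨hdom, _, hd t ht.le, ?_⟩
  rw [e]
  have hI : Complex.I ^ 2 = -1 := Complex.I_sq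
  -- The coefficient of `gaussianL2 2` is the Riccati equation, that of `gaussianL2 0` the transport
  -- equation.
  match_scalars
  · linear_combination (-Complex.exp (a t) * ((t : ℂ) ^ 3 - ((t : ℂ) ^ 3)⁻¹ * b t ^ 2)) * hI
  · linear_combination (-Complex.exp (a t) * ((t : ℂ) ^ 3)⁻¹ * b t) * hI

/-- The parameters of the Gaussian solution, in terms of a complex classical solution `p + i q`. -/
theorem exists_gaussian_parameters {t₀ : ℝ} (ht₀ : 0 < t₀) (a₀ : ℂ) :
    ∃ (a b : ℝ → ℂ) (r : ℝ → ℝ), a t₀ = a₀ ∧ b t₀ = 1 / 2 ∧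
      (∀ t ≥ t₀, 0 < r t) ∧ (r =Θ[atTop] fun t => t ^ (-3 : ℤ)) ∧
      (∀ t ≥ t₀, (b t).re = (2 * r t)⁻¹) ∧
      (∀ t ≥ t₀, ‖Complex.exp (a t)‖ ^ 2 * √(r t) = ‖Complex.exp a₀‖ ^ 2) ∧
      (∀ t ≥ t₀, HasDerivAt a (-Complex.I * ((t : ℂ) ^ 3)⁻¹ * b t) t) ∧
      (∀ t ≥ t₀,
        HasDerivAt b (2 * Complex.I * ((t : ℂ) ^ 3 - ((t : ℂ) ^ 3)⁻¹ * b t ^ 2)) t) := by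
  -- The initial data `u = 1`, `u' = i t₀⁻³` give both `b = 1 / 2` and normalised Wronskian `1` at
  -- `t₀`.
  obtain ⟨p, p', hp0, hp0', hp⟩ := exists_isClassicalSolution ht₀ 1 0
  obtain ⟨q, q', hq0, hq0', hq⟩ := exists_isClassicalSolution ht₀ 0 (t₀ ^ 3)⁻¹
  have hw : t₀ ^ 3 * (p t₀ * q' t₀ - q t₀ * p' t₀) = 1 := by
    rw [hp0, hq0, hp0', hq0']
    field_simp
    ring
  have hW : ∀ t ≥ t₀, t ^ 3 * (p t * q' t - q t * p' t) = 1 := fun t ht =>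
    (hp.wronskian ht₀ hq ht).trans hw
  have hr : ∀ t ≥ t₀, 0 < p t ^ 2 + q t ^ 2 := by
    intro t ht
    refine lt_of_le_of_ne (by positivity) fun h => ?_
    have h1 : p t = 0 := by nlinarith [sq_nonneg (p t), sq_nonneg (q t)]
    have h2 : q t = 0 := by nlinarith [sq_nonneg (p t), sq_nonneg (q t)]
    have := hW t ht
    simp [h1, h2] at this
  let u : ℝ → ℂ := fun t => (p t : ℂ) + q t * Complex.I
  let w : ℝ → ℂ := fun t => (p' t : ℂ) + q' t * Complex.I
  have hu2 : ∀ t, ‖u t‖ ^ 2 = p t ^ 2 + q t ^ 2 := fun t => by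
    rw [Complex.sq_norm, Complex.normSq_add_mul_I]
  have hu0 : ∀ t ≥ t₀, u t ≠ 0 := fun t ht h => by
    have := hr t ht
    rw [← hu2, h] at this
    simp at this
  have hu : ∀ t ≥ t₀, HasDerivAt u (w t) t := fun t ht =>
    (hp t ht).1.ofReal_comp.add ((hq t ht).1.ofReal_comp.mul_const Complex.I)
  have hw' : ∀ t ≥ t₀, HasDerivAt w (-4 * u t - 3 / t * w t) t := fun t ht =>
    ((hp t ht).2.ofReal_comp.add ((hq t ht).2.ofReal_comp.mul_const Complex.I)).congr_deriv (by
      simp only [u, w]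
      push_cast
      ring)
  let F : ℝ → ℂ := fun t => -w (max t t₀) / (2 * u (max t t₀))
  have hF : Continuous F := by
    have hmax : Continuous fun t => max t t₀ := by fun_prop
    have hwc : Continuous fun t => w (max t t₀) := continuous_iff_continuousAt.2 fun t =>
      (hw' _ (le_max_right t t₀)).continuousAt.comp (f := fun t => max t t₀) hmax.continuousAt
    have huc : Continuous fun t => u (max t t₀) := continuous_iff_continuousAt.2 fun t =>
      (hu _ (le_max_right t t₀)).continuousAt.comp (f := fun t => max t t₀) hmax.continuousAt
    exact hwc.neg.div (continuous_const.mul huc) fun t =>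
      mul_ne_zero two_ne_zero (hu0 _ (le_max_right t t₀))
  -- Formally `a = a₀ - (1/2) log u`; integrating `-u' / (2 u)` avoids a branch of the logarithm.
  let a : ℝ → ℂ := fun t => a₀ + ∫ s in t₀..t, F s
  have ha0 : a t₀ = a₀ := by simp [a]
  have ha : ∀ t ≥ t₀, HasDerivAt a (-w t / (2 * u t)) t := fun t ht => by
    have h := (hF.integral_hasStrictDerivAt t₀ t).hasDerivAt.const_add a₀
    simpa only [F, max_eq_left ht] using h
  let b : ℝ → ℂ := fun t => -Complex.I / 2 * (t : ℂ) ^ 3 * (w t / u t)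
  have hut0 : u t₀ = 1 := by simp [u, hp0, hq0]
  have hwt0 : w t₀ = ((t₀ : ℂ) ^ 3)⁻¹ * Complex.I := by simp [w, hp0', hq0']
  have hI : Complex.I ^ 2 = -1 := Complex.I_sq
  have htC : ∀ t ≥ t₀, (t : ℂ) ≠ 0 := fun t ht =>
    Complex.ofReal_ne_zero.2 (ht₀.trans_le ht).ne'
  refine ⟨a, b, fun t => p t ^ 2 + q t ^ 2, ha0, ?_, hr, hp.isTheta ht₀ hq hw, ?_, ?_, ?_, ?_⟩
  · have := htC t₀ le_rfl
    simp only [b, hut0, hwt0]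
    field_simp
    linear_combination -hI
  · intro t ht
    have h1 := hr t ht
    have h2 := hW t ht
    have e : b t = ((t ^ 3 / 2 : ℝ) : ℂ) * (-Complex.I * (w t / u t)) := by
      simp only [b]; push_cast; ring
    rw [e, Complex.re_ofReal_mul]
    have e2 : (-Complex.I * (w t / u t)).re = (p t * q' t - q t * p' t) / (p t ^ 2 + q t ^ 2) := by
      rw [neg_mul, Complex.neg_re, Complex.I_mul_re, neg_neg, Complex.div_im, ← Complex.sq_norm,
        hu2]
      simp [u, w]
      ring
    rw [e2]
    field_simp
    linarith
  · intro t ht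
    -- From `a' = -u' / (2 u)`, the product `e^(2a) u` is constant; its modulus is the claim.
    have hc : ∀ s ≥ t₀, HasDerivAt (fun s => Complex.exp (a s) ^ 2 * u s) 0 s := fun s hs => by
      have hus := hu0 s hs
      refine (((ha s hs).cexp.pow 2).mul (hu s hs)).congr_deriv ?_
      simp only [Pi.pow_apply]
      field_simp
      push_cast
      ring
    have h := congrArg norm (eq_of_hasDerivAt_zero hc ht)
    simp only [ha0, hut0, norm_mul, norm_pow, mul_one] at h
    dsimp only
    rw [← h, ← hu2, Real.sqrt_sq (norm_nonneg _)]
  · intro t ht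
    refine (ha t ht).congr_deriv ?_
    have h1 := htC t ht
    have h2 := hu0 t ht
    simp only [b]
    field_simp
    linear_combination (-w t) * hI
  · intro t ht
    have h1 := htC t ht
    have h2 := hu0 t ht
    have h3 := (((hasDerivAt_id t).ofReal_comp.pow 3).const_mul (-Complex.I / 2)).mul
      ((hw' t ht).div (hu t ht) h2)
    refine h3.congr_deriv ?_
    simp only [b, Pi.pow_apply, Pi.div_apply, id_eq]
    field_simp
    push_cast
    linear_combination ((t : ℂ) ^ 3 * w t ^ 2) * hI

theorem gaussianWave_eq_gaussian :
    gaussianWave (Real.log ((1 / (2 * Real.pi)) ^ (1 / 4 : ℝ)) : ℝ) (1 / 2)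
      =ᵐ[volume] gaussian := by
  have hb : (0 : ℝ) < (1 / 2 : ℂ).re := by norm_num
  filter_upwards [coeFn_gaussianWave _ hb] with x hx
  rw [hx, ← Complex.ofReal_exp, Real.exp_log (by positivity), gaussian, monomialGaussian]
  push_cast
  rw [pow_zero, one_mul]
  congr 2
  ring

end QHD

theorem mainTheorem5 (t₀ : ℝ) (ht₀ : 0 < t₀) :
    (∃ Ψ : ℝ → QHD.L2,
      QHD.IsSolution (QHD.hamiltonian QHD.alpha QHD.beta QHD.gamma QHD.objective)
        t₀ QHD.gaussian Ψ) ∧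
    (∀ Ψ Φ : ℝ → QHD.L2,
      QHD.IsSolution (QHD.hamiltonian QHD.alpha QHD.beta QHD.gamma QHD.objective)
        t₀ QHD.gaussian Ψ →
      QHD.IsSolution (QHD.hamiltonian QHD.alpha QHD.beta QHD.gamma QHD.objective)
        t₀ QHD.gaussian Φ →
      EqOn Ψ Φ (Ici t₀)) ∧
    (∀ Ψ : ℝ → QHD.L2,
      QHD.IsSolution (QHD.hamiltonian QHD.alpha QHD.beta QHD.gamma QHD.objective)
        t₀ QHD.gaussian Ψ →
      (∀ t ≥ t₀, Integrable (fun x => QHD.objective x * ‖Ψ t x‖ ^ 2)) ∧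
      (fun t => QHD.expectation QHD.objective (Ψ t)) =Θ[atTop] (fun t => t ^ (-3 : ℤ))) := by
  obtain ⟨a, b, r, ha0, hb0, hr, hrΘ, hbr, har, ha, hb⟩ := QHD.exists_gaussian_parameters ht₀
    (Real.log ((1 / (2 * Real.pi)) ^ (1 / 4 : ℝ)) : ℝ)
  have hbpos : ∀ t ≥ t₀, 0 < (b t).re := fun t ht => by
    rw [hbr t ht]
    exact inv_pos.2 (mul_pos two_pos (hr t ht))
  have hsol := QHD.isSolution_gaussianWave ht₀ (Ψ₀ := QHD.gaussian) hbpos ha hb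
    (by rw [ha0, hb0]; exact QHD.gaussianWave_eq_gaussian)
  refine ⟨⟨_, hsol⟩, fun Ψ Φ hΨ hΦ => hΨ.eqOn ht₀ hΦ, fun Ψ hΨ => ?_⟩
  have hE := hΨ.eqOn ht₀ hsol
  refine ⟨fun t ht => ?_, ?_⟩
  · rw [hE ht]
    exact QHD.integrable_objective_gaussianWave _ (hbpos t ht)
  set κ := ‖Complex.exp (Real.log ((1 / (2 * Real.pi)) ^ (1 / 4 : ℝ)) : ℝ)‖ ^ 2
  have hκ : 0 < κ := pow_pos (norm_pos_iff.2 (Complex.exp_ne_zero _)) 2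
  have hK := QHD.integral_sq_mul_exp_neg_sq_pos
  set K := ∫ x : ℝ, x ^ 2 * Real.exp (-1 * x ^ 2)
  -- With `Re b = 1 / (2 r)`, the moment is `(|e^a|² / 2) (2 r)^(3/2) K`, and `|e^a|² √r = κ` leaves
  -- one factor `r`.
  have key : (fun t => QHD.expectation QHD.objective (Ψ t)) =ᶠ[atTop]
      fun t => (κ * √2 * K) * r t := by
    filter_upwards [eventually_ge_atTop t₀] with t ht
    rw [hE ht, QHD.expectation_gaussianWave _ (hbpos t ht), hbr t ht, Real.sqrt_inv, inv_inv,
      inv_inv, Real.sqrt_mul zero_le_two, ← har t ht]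
    ring
  exact key.isTheta.trans (hrΘ.const_mul_left (by positivity))
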